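/- Let $n\in\mathbb N$, $m\in\{0,\dots,n-1\}$, $s>m$ and $0<\alpha\le 1$. Then there is a constant $c=c(n,m,s,\alpha)>0$, depending only on $n,m,s,\alpha$, such that for every finite Borel regular (outer) measure $\mu$ on $\mathbb R^n$ with $\dim_H(\mu)\ge s$, $$\limsup_{r\downarrow 0}\ \inf_{\substack{\theta\in S^{n-1}\\ V\in G(n,n-m)}}\frac{\mu\bigl(X(x,r,V,\alpha)\setminus H(x,\theta,\alpha)\bigr)}{\mu\bigl(B(x,r)\bigr)}>c\qquad\text{for }\mu\text{-almost every }x\in\mathbb R^n .$$ Here $|\cdot|$ is the Euclidean norm, $B(x,r)$ is the closed ball, $S^{n-1}$ is the unit sphere, $G(n,n-m)$ is the set of all $(n-m)$-dimensional linear subspaces of $\mathbb R^n$, $$H(x,\theta,\alpha)=\{y\in\mathbb R^n:(y-x)\cdot\theta>\alpha|y-x|\},\qquad X(x,r,V,\alpha)=\{y\in B(x,r):\operatorname{dist}(y-x,V)<\alpha|y-x|\},$$ and $\dim_H(\mu)=\inf\{\dim_H(A): A\subset\mathbb R^n\text{ Borel},\ \mu(A)>0\}$, where $\dim_H(A)$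 is the Hausdorff dimension of the set $A$. -/

import Mathlib

open Filter Topology MeasureTheory
open scoped ENNReal

noncomputable section

namespace ConicalDensity

/-- `ℝⁿ` with its Euclidean norm and inner product. -/
abbrev Rn (n : ℕ) : Type := EuclideanSpace ℝ (Fin n)

/-- The unit sphere `S^{n-1}` of `ℝⁿ`. -/
def unitSphere (n : ℕ) : Set (Rn n) := Metric.sphere 0 1

/-- The Grassmannian `G(n,k)`: all `k`-dimensional linear subspaces of `ℝⁿ`. -/
def grassmannian (n k : ℕ) : Set (Submodule ℝ (Rn n)) := {V | Module.finrank ℝ V = k}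

/-- `H(x,θ,α) = {y : (y - x) · θ > α |y - x|}`. -/
def H {n : ℕ} (x θ : Rn n) (α : ℝ) : Set (Rn n) :=
  {y | inner ℝ (y - x) θ > α * ‖y - x‖}

/-- The two-sided cone `X(x,V,α) = {y : dist(y - x, V) < α |y - x|}` around `x + V`. -/
def cone {n : ℕ} (x : Rn n) (V : Submodule ℝ (Rn n)) (α : ℝ) : Set (Rn n) :=
  {y | Metric.infDist (y - x) (V : Set (Rn n)) < α * ‖y - x‖}

/-- The truncated cone `X(x,r,V,α) = B(x,r) ∩ X(x,V,α)`, where `B(x,r)` is the closed ball. -/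
def truncCone {n : ℕ} (x : Rn n) (r : ℝ) (V : Submodule ℝ (Rn n)) (α : ℝ) : Set (Rn n) :=
  Metric.closedBall x r ∩ cone x V α

/-- The (lower) Hausdorff dimension of a measure:
`dim_H μ = inf {dim_H A : A Borel, μ A > 0}`, an element of `[0,∞]`. -/
def hausdorffDim {n : ℕ} (μ : Measure (Rn n)) : ℝ≥0∞ :=
  ⨅ (A : Set (Rn n)) (_ : MeasurableSet A) (_ : 0 < μ A), dimH A

end ConicalDensity

end

/-!
Suppose that on a set `S` of positive measure, at every small scale, some cone minus a half-space
carries at most a small proportion `c` of the mass of the ball. Split a cube of a `B`-adic grid into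
its `Bⁿ` subcubes and call a subcube heavy if it carries more than the proportion `c` of the mass
near the cube. At a point of `S` in a heavy subcube, no heavy subcube is contained in the cone minus
the half-space. Colour the heavy subcubes by approximations of the direction `θ`, of an orthonormal
basis of `Vᗮ`, and of their position along that basis. Two well separated subcubes of the same
colour lie in each other's cone, hence each lies in the half-space of the other, which is impossible
as the two directions nearly agree. As there are `O(Bᵐ)` colours, at most `O(Bᵐ)` subcubes are
heavy.

The light subcubes of one generation carry mass `O(c Bⁿ)`, so by Markov's inequality a set of
positive measure consists of points which, for infinitely many `l`, meet light subcubes at most `l`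
times during the first `D l` generations. Counting the paths in the grid, the points doing so for
a given `l` are covered by `O(((C Bᵐ) ^ D * Bⁿ) ^ l)` cubes of side length comparable to
`B ^ (-D l)`. For `d > m`, choosing `D` and then `B` large makes the dimension of the set at most
`d`; so `d` between `m` and `s` contradicts `dim_H μ ≥ s`.
-/

namespace ConicalDensity

section TreeCounting

open Classical in
theorem exists_card_le_of_count_le {ι : Type*} (children : ι → Finset ι) (bad : ℕ → Set ι)
    {N M : ℕ} (hM₀ : 1 ≤ M) (hM : ∀ p, (children p).card ≤ M)
    (hN : ∀ j p, {q ∈ children p | q ∉ bad j}.card ≤ N) (F₀ : Finset ι) (J b : ℕ) :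
    ∃ F : Finset ι, F.card ≤ F₀.card * (N + 1) ^ J * M ^ b ∧
      ∀ q : ℕ → ι, q 0 ∈ F₀ → (∀ j, q (j + 1) ∈ children (q j)) →
        Nat.count (fun j => q (j + 1) ∈ bad j) J ≤ b → q J ∈ F := by
  induction J generalizing b with
  | zero => exact ⟨F₀, by simpa using Nat.le_mul_of_pos_right _ (by positivity), fun q h _ _ => h⟩
  | succ J ih =>
    obtain ⟨F, hFcard, hF⟩ := ih b
    let good : ι → Finset ι := fun p => {q ∈ children p | q ∉ bad J}
    have hgood : (F.biUnion good).card ≤ F.card * N :=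
      Finset.card_biUnion_le_card_mul _ _ N fun p _ => hN J p
    cases b with
    | zero =>
      refine ⟨F.biUnion good, ?_, fun q h₀ hq hb => ?_⟩
      · calc (F.biUnion good).card ≤ F.card * N := hgood
          _ ≤ (F₀.card * (N + 1) ^ J * M ^ 0) * (N + 1) := by gcongr; omega
          _ = _ := by ring
      · rw [Nat.count_succ] at hb
        have hqJ : q (J + 1) ∉ bad J := fun h => by simp [h] at hb
        exact Finset.mem_biUnion.2
          ⟨q J, hF q h₀ hq (by omega), Finset.mem_filter.2 ⟨hq J, hqJ⟩⟩
    | succ b =>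
      obtain ⟨E, hEcard, hE⟩ := ih b
      have hchildren : (E.biUnion children).card ≤ E.card * M :=
        Finset.card_biUnion_le_card_mul _ _ M fun p _ => hM p
      refine ⟨F.biUnion good ∪ E.biUnion children, ?_, fun q h₀ hq hb => ?_⟩
      · calc (F.biUnion good ∪ E.biUnion children).card ≤ F.card * N + E.card * M :=
              (Finset.card_union_le _ _).trans (Nat.add_le_add hgood hchildren)
          _ ≤ (F₀.card * (N + 1) ^ J * M ^ (b + 1)) * N + (F₀.card * (N + 1) ^ J * M ^ b) * M := by
              gcongr
          _ = _ := by ring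
      · rw [Nat.count_succ] at hb
        by_cases hqJ : q (J + 1) ∈ bad J
        · rw [if_pos hqJ] at hb
          exact Finset.mem_union_right _
            (Finset.mem_biUnion.2 ⟨q J, hE q h₀ hq (by omega), hq J⟩)
        · rw [if_neg hqJ] at hb
          exact Finset.mem_union_left _ (Finset.mem_biUnion.2
            ⟨q J, hF q h₀ hq (by omega), Finset.mem_filter.2 ⟨hq J, hqJ⟩⟩)

end TreeCounting

section HausdorffMeasure

variable {X ι : Type*} [EMetricSpace X] [MeasurableSpace X] [BorelSpace X] {d : ℝ}

theorem hausdorffMeasure_limsup_cofinite_eq_zero [Countable ι] (hd : 0 < d) {t : ι → Set X}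
    (ht : ∑' i, Metric.ediam (t i) ^ d ≠ ⊤) : μH[d] (limsup t cofinite) = 0 := by
  let tail : Finset ι → ℝ≥0∞ := fun s => ∑' i : {i // i ∉ s}, Metric.ediam (t i) ^ d
  have htail : Tendsto tail atTop (𝓝 0) := ENNReal.tendsto_tsum_compl_atTop_zero ht
  have hradius : Tendsto (fun s => tail s ^ d⁻¹) atTop (𝓝 0) := by
    have := ((ENNReal.continuous_rpow_const (y := d⁻¹)).tendsto 0).comp htail
    rwa [ENNReal.zero_rpow_of_pos (inv_pos.2 hd)] at this
  have hdiam : ∀ s, ∀ i : {i // i ∉ s}, Metric.ediam (t i) ≤ tail s ^ d⁻¹ := fun s i =>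
    (ENNReal.le_rpow_inv_iff hd).2 (ENNReal.le_tsum (f := fun i : {i // i ∉ s} => _) i)
  have hcover : ∀ s : Finset ι, limsup t cofinite ⊆ ⋃ i : {i // i ∉ s}, t i := fun s x hx => by
    obtain ⟨i, hxi, his⟩ := ((mem_limsup_iff_frequently_mem.1 hx).and_eventually
      s.finite_toSet.eventually_cofinite_notMem).exists
    exact Set.mem_iUnion.2 ⟨⟨i, his⟩, hxi⟩
  refine le_antisymm ?_ zero_le
  calc μH[d] (limsup t cofinite) ≤ liminf tail atTop :=
        Measure.hausdorffMeasure_le_liminf_tsum d _ _ hradius (fun s (i : {i // i ∉ s}) => t i)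
          (Eventually.of_forall hdiam) (Eventually.of_forall hcover)
    _ = 0 := htail.liminf_eq

theorem hausdorffMeasure_frequently_mem_eq_zero (hd : 0 < d) (F : ℕ → Finset ι)
    {t : ℕ → ι → Set X} {A ρ a b : ℝ≥0∞} (ha : a ≠ ⊤) (hb : b ≠ ⊤) (hA : A * ρ ^ d < 1)
    (hF : ∀ l, ((F l).card : ℝ≥0∞) ≤ a * A ^ l) (ht : ∀ l q, Metric.ediam (t l q) ≤ b * ρ ^ l) :
    μH[d] {x | ∃ᶠ l in atTop, ∃ q ∈ F l, x ∈ t l q} = 0 := by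
  have hpow : ∀ l : ℕ, (ρ ^ l) ^ d = (ρ ^ d) ^ l := fun l => by
    rw [← ENNReal.rpow_natCast, ← ENNReal.rpow_mul, mul_comm, ENNReal.rpow_mul,
      ENNReal.rpow_natCast]
  have hlevel : ∀ l, ∑' q : F l, Metric.ediam (t l q) ^ d ≤ a * b ^ d * (A * ρ ^ d) ^ l := fun l =>
    calc ∑' q : F l, Metric.ediam (t l q) ^ d ≤ ∑' _ : F l, (b * ρ ^ l) ^ d :=
          ENNReal.tsum_le_tsum fun q => ENNReal.rpow_le_rpow (ht l q) hd.le
      _ = (F l).card * (b * ρ ^ l) ^ d := by simp [tsum_fintype]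
      _ ≤ a * A ^ l * (b ^ d * (ρ ^ d) ^ l) := by
          rw [ENNReal.mul_rpow_of_nonneg _ _ hd.le, hpow]
          gcongr
          exact hF l
      _ = a * b ^ d * (A * ρ ^ d) ^ l := by ring
  have hsum : ∑' i : Σ l, F l, Metric.ediam (t i.1 i.2) ^ d ≠ ⊤ := by
    rw [ENNReal.tsum_sigma fun l (q : F l) => Metric.ediam (t l q) ^ d]
    refine ((ENNReal.tsum_le_tsum hlevel).trans_lt ?_).ne
    rw [ENNReal.tsum_mul_left, ENNReal.tsum_geometric]
    have := ENNReal.inv_ne_top.2 (tsub_pos_of_lt hA).ne'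
    finiteness
  refine measure_mono_null (fun x hx => ?_) (hausdorffMeasure_limsup_cofinite_eq_zero hd hsum)
  rw [mem_limsup_iff_frequently_mem, frequently_cofinite_iff_infinite]
  refine .of_image Sigma.fst ((Nat.frequently_atTop_iff_infinite.1 hx).mono ?_)
  rintro l ⟨q, hq, hxq⟩
  exact ⟨⟨l, q, hq⟩, hxq, rfl⟩

end HausdorffMeasure

section MeasureEstimates

variable {X : Type*} [MeasurableSpace X] {μ : Measure X}

theorem measure_limsup_atTop_ge [IsFiniteMeasure μ] {P : ℕ → Set X}
    (hP : ∀ l, MeasurableSet (P l)) {a : ℝ≥0∞} (ha : ∀ l, a ≤ μ (P l)) :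
    a ≤ μ (limsup P atTop) := by
  have hanti : Antitone fun i => ⋃ l ≥ i, P l := fun i j hij =>
    Set.biUnion_subset_biUnion_left fun l hl => hij.trans hl
  rw [limsup_eq_iInf_iSup_of_nat]
  simp only [Set.iSup_eq_iUnion, Set.iInf_eq_iInter]
  rw [hanti.measure_iInter
    (fun i => (MeasurableSet.iUnion fun l => .iUnion fun _ => hP l).nullMeasurableSet)
    ⟨0, measure_ne_top μ _⟩]
  exact le_iInf fun i => (ha i).trans
    (measure_mono (Set.subset_iUnion₂_of_subset i le_rfl subset_rfl))

open Classical in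
theorem measurable_count_mem {E : ℕ → Set X} (hE : ∀ j, MeasurableSet (E j)) (J : ℕ) :
    Measurable fun x => Nat.count (fun j => x ∈ E j) J := by
  induction J with
  | zero => simp
  | succ J ih =>
    simp only [Nat.count_succ]
    exact ih.add (Measurable.ite (hE J) measurable_const measurable_const)

open Classical in
theorem measurableSet_frequently_count_le {E : ℕ → Set X} (hE : ∀ j, MeasurableSet (E j))
    (D : ℕ) : MeasurableSet {x | ∃ᶠ l in atTop, Nat.count (fun j => x ∈ E j) (D * l) ≤ l} := by
  have hP : ∀ l, MeasurableSet {x | Nat.count (fun j => x ∈ E j) (D * l) ≤ l} := fun l =>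
    measurableSet_le (measurable_count_mem hE _) measurable_const
  have hlimsup : {x | ∃ᶠ l in atTop, Nat.count (fun j => x ∈ E j) (D * l) ≤ l} =
      limsup (fun l => {x | Nat.count (fun j => x ∈ E j) (D * l) ≤ l}) atTop :=
    Set.ext fun x => by rw [mem_limsup_iff_frequently_mem]; rfl
  exact hlimsup ▸ MeasurableSet.measurableSet_limsup hP

open Classical in
theorem mul_measure_le_count_le_sum {E : ℕ → Set X} (hE : ∀ j, MeasurableSet (E j)) (J b : ℕ) :
    b * μ {x | b ≤ Nat.count (fun j => x ∈ E j) J} ≤ ∑ j ∈ Finset.range J, μ (E j) := by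
  have hcount : ∀ x, (Nat.count (fun j => x ∈ E j) J : ℝ≥0∞) =
      ∑ j ∈ Finset.range J, (E j).indicator 1 x := fun x => by
    rw [Nat.count_eq_card_filter_range, Finset.card_filter]
    push_cast
    rfl
  calc b * μ {x | b ≤ Nat.count (fun j => x ∈ E j) J}
      = b * μ {x | (b : ℝ≥0∞) ≤ Nat.count (fun j => x ∈ E j) J} := by simp only [Nat.cast_le]
    _ ≤ ∫⁻ x, Nat.count (fun j => x ∈ E j) J ∂μ :=
        mul_meas_ge_le_lintegral ((measurable_from_top (f := Nat.cast)).comp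
          (measurable_count_mem hE J)) _
    _ = ∑ j ∈ Finset.range J, μ (E j) := by
        simp only [hcount]
        rw [lintegral_finsetSum _ fun j _ => measurable_one.indicator (hE j)]
        simp only [lintegral_indicator_one (hE _)]

open Classical in
theorem half_measure_univ_le_measure_frequently_count_le [IsFiniteMeasure μ] {E : ℕ → Set X}
    (hE : ∀ j, MeasurableSet (E j)) {κ : ℝ≥0∞} (hκ : ∀ j, μ (E j) ≤ κ)
    {D : ℕ} (hD : D * κ ≤ μ Set.univ / 2) :
    μ Set.univ / 2 ≤
      μ {x | ∃ᶠ l in atTop, Nat.count (fun j => x ∈ E j) (D * l) ≤ l} := by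
  let P : ℕ → Set X := fun l => {x | Nat.count (fun j => x ∈ E j) (D * l) ≤ l}
  have hP : ∀ l, MeasurableSet (P l) := fun l =>
    measurableSet_le (measurable_count_mem hE _) measurable_const
  have hmarkov : ∀ l, μ (P l)ᶜ ≤ μ Set.univ / 2 := fun l => by
    have hmul : ((l + 1 : ℕ) : ℝ≥0∞) * μ (P l)ᶜ ≤ (l + 1 : ℕ) * (μ Set.univ / 2) := by
      calc ((l + 1 : ℕ) : ℝ≥0∞) * μ (P l)ᶜ
          = (l + 1 : ℕ) * μ {x | l + 1 ≤ Nat.count (fun j => x ∈ E j) (D * l)} := by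
            congr 2; ext x; simp [P]
        _ ≤ ∑ j ∈ Finset.range (D * l), μ (E j) := mul_measure_le_count_le_sum hE _ _
        _ ≤ ∑ _j ∈ Finset.range (D * l), κ := Finset.sum_le_sum fun j _ => hκ j
        _ = l * (D * κ) := by
            rw [Finset.sum_const, Finset.card_range, nsmul_eq_mul]
            push_cast
            ring
        _ ≤ (l + 1 : ℕ) * (μ Set.univ / 2) := by gcongr; omega
    exact (ENNReal.mul_le_mul_iff_right (by simp) (ENNReal.natCast_ne_top _)).1 hmul
  have hhalf : ∀ l, μ Set.univ / 2 ≤ μ (P l) := fun l => by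
    have hcompl := measure_compl (hP l).compl (measure_ne_top μ _)
    rw [compl_compl] at hcompl
    rw [hcompl, ← ENNReal.sub_half (measure_ne_top μ _)]
    gcongr
    exact hmarkov l
  refine (measure_limsup_atTop_ge hP hhalf).trans (measure_mono fun x hx => ?_)
  exact mem_limsup_iff_frequently_mem.1 hx

theorem tsum_measure_inter_le_of_card_le {ι : Type*} [Countable ι] {A : ι → Set X}
    (hA : ∀ i, MeasurableSet (A i)) (U : Set X) {M : ℕ} (F : X → Finset ι)
    (hF : ∀ x i, x ∈ A i → i ∈ F x) (hM : ∀ x, (F x).card ≤ M) :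
    ∑' i, μ (A i ∩ U) ≤ M * μ U := by
  have hmult : ∀ x, ∑' i, (A i).indicator (1 : X → ℝ≥0∞) x ≤ M := fun x =>
    calc ∑' i, (A i).indicator (1 : X → ℝ≥0∞) x = ∑ i ∈ F x, (A i).indicator 1 x :=
          tsum_eq_sum fun i hi => Set.indicator_of_notMem (fun hx => hi (hF x i hx)) _
      _ ≤ ∑ _i ∈ F x, 1 := Finset.sum_le_sum fun i _ => Set.indicator_le_self _ _ x
      _ = (F x).card := by simp
      _ ≤ M := by exact_mod_cast hM x
  calc ∑' i, μ (A i ∩ U) = ∑' i, ∫⁻ x in U, (A i).indicator 1 x ∂μ := by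
        simp only [lintegral_indicator_one (hA _), Measure.restrict_apply (hA _)]
    _ = ∫⁻ x in U, ∑' i, (A i).indicator 1 x ∂μ :=
        (lintegral_tsum fun i => (measurable_one.indicator (hA i)).aemeasurable).symm
    _ ≤ ∫⁻ _x in U, M ∂μ := lintegral_mono hmult
    _ = M * μ U := by simp

theorem exists_isCompact_forall_inter_nonempty [TopologicalSpace X] [OpensMeasurableSpace X]
    [SFinite μ] [μ.InnerRegular] {S : Set X} (hS : μ S ≠ 0) :
    ∃ K, IsCompact K ∧ μ K ≠ 0 ∧ ∀ A, MeasurableSet A → μ (A ∩ K) ≠ 0 → (A ∩ S).Nonempty := by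
  obtain ⟨K, hKS, hK, hμK⟩ := (measurableSet_toMeasurable μ S).exists_lt_isCompact (r := 0)
    (by rwa [measure_toMeasurable, pos_iff_ne_zero])
  refine ⟨K, hK, hμK.ne', fun A hA hAK => ?_⟩
  rw [Set.inter_comm]
  refine nonempty_of_measure_ne_zero (μ := μ) ?_
  rw [← Measure.measure_toMeasurable_inter_of_sFinite hA]
  have hsub : A ∩ K ⊆ toMeasurable μ S ∩ A := fun x hx => ⟨hKS hx.2, hx.1⟩
  exact fun h => hAK (measure_mono_null hsub h)

theorem exists_measure_cthickening_lt_two_mul {Y : Type*} [MetricSpace Y] [ProperSpace Y]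
    [MeasurableSpace Y] [OpensMeasurableSpace Y] {μ : Measure Y} [IsFiniteMeasureOnCompacts μ]
    {K : Set Y} (hK : IsCompact K) (hμK : μ K ≠ 0) :
    ∃ δ > 0, μ (Metric.cthickening δ K) < 2 * μ K := by
  have hlt : μ K < 2 * μ K := by
    rw [two_mul]
    exact ENNReal.lt_add_right hK.measure_lt_top.ne hμK
  have hev : ∀ᶠ δ in 𝓝[>] (0 : ℝ), μ (Metric.cthickening δ K) < 2 * μ K :=
    ((tendsto_measure_cthickening_of_isCompact hK).eventually_lt_const hlt).filter_mono
      nhdsWithin_le_nhds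
  obtain ⟨δ, hδK, hδ⟩ := (hev.and self_mem_nhdsWithin).exists
  exact ⟨δ, hδ, hδK⟩

theorem exists_measure_ne_zero_of_eventually_nhdsGT {p : X → ℝ → Prop}
    (hp : μ {x | ∀ᶠ r in 𝓝[>] 0, p x r} ≠ 0) :
    ∃ r₀ > 0, μ {x | ∀ r, 0 < r → r < r₀ → p x r} ≠ 0 := by
  by_contra! hnull
  refine hp (measure_mono_null (fun x hx => ?_)
    (measure_iUnion_null fun j : ℕ => hnull (1 / ((j : ℝ) + 1)) (by positivity)))
  obtain ⟨u, hu, hIoo⟩ := mem_nhdsGT_iff_exists_Ioo_subset.1 hx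
  obtain ⟨j, hj⟩ := exists_nat_one_div_lt (Set.mem_Ioi.1 hu)
  exact Set.mem_iUnion.2 ⟨j, fun r hr hrj => hIoo ⟨hr, hrj.trans hj⟩⟩

end MeasureEstimates

section Directions

variable {E : Type*} [NormedAddCommGroup E] [InnerProductSpace ℝ E]

theorem abs_inner_sub_inner_le {w w' u τ : E} {ε δ : ℝ} (hu : ‖u - τ‖ ≤ ε) (hτ : ‖τ‖ ≤ 1)
    (hw : ‖w - w'‖ ≤ δ) : |inner ℝ w u - inner ℝ w' τ| ≤ ε * ‖w‖ + δ := by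
  have hsplit : inner ℝ w u - inner ℝ w' τ = inner ℝ w (u - τ) + inner ℝ (w - w') τ := by
    rw [inner_sub_right, inner_sub_left]
    ring
  calc |inner ℝ w u - inner ℝ w' τ| ≤ |inner ℝ w (u - τ)| + |inner ℝ (w - w') τ| :=
        hsplit ▸ abs_add_le _ _
    _ ≤ ‖w‖ * ‖u - τ‖ + ‖w - w'‖ * ‖τ‖ :=
        add_le_add (abs_real_inner_le_norm _ _) (abs_real_inner_le_norm _ _)
    _ ≤ ‖w‖ * ε + δ * 1 := by gcongr; exact (norm_nonneg _).trans hw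
    _ = ε * ‖w‖ + δ := by ring

theorem floor_inner_div_mem_Icc {w τ : E} {δ : ℝ} {N : ℕ} (hδ : 0 < δ) (hw : ‖w‖ ≤ N * δ)
    (hτ : ‖τ‖ ≤ 1) : ⌊inner ℝ w τ / δ⌋ ∈ Finset.Icc (-N : ℤ) N := by
  have habs : |inner ℝ w τ / δ| ≤ N := by
    rw [abs_div, abs_of_pos hδ, div_le_iff₀ hδ]
    calc |inner ℝ w τ| ≤ ‖w‖ * ‖τ‖ := abs_real_inner_le_norm _ _
      _ ≤ ‖w‖ := mul_le_of_le_one_right (norm_nonneg _) hτ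
      _ ≤ N * δ := hw
  obtain ⟨hlower, hupper⟩ := abs_le.1 habs
  exact Finset.mem_Icc.2 ⟨Int.le_floor.2 (by push_cast; exact hlower),
    Int.floor_le_iff.2 (by push_cast; linarith)⟩

/- The colour of `q` consists of `t q`, of `τ q` and of the integer parts of the coordinates of
`y q` along `τ q`. Two elements of the same colour would give opposite inner products with `t q`. -/
theorem card_le_of_forall_inner_pos {ι κ : Type*} [Fintype κ] {G : Finset ι} {T : Finset E}
    (hT : ∀ τ ∈ T, ‖τ‖ ≤ 1) {y t : ι → E} {τ : ι → κ → E} (ht : ∀ q ∈ G, t q ∈ T)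
    (hτ : ∀ q ∈ G, ∀ i, τ q i ∈ T) {δ : ℝ} (hδ : 0 < δ) {N : ℕ}
    (hN : ∀ q ∈ G, ∀ q' ∈ G, ‖y q' - y q‖ ≤ N * δ)
    (hpos : ∀ q ∈ G, ∀ q' ∈ G, q ≠ q' → (∀ i, |inner ℝ (y q' - y q) (τ q i)| ≤ δ) →
      0 < inner ℝ (y q' - y q) (t q)) :
    G.card ≤ T.card * T.card ^ Fintype.card κ * (2 * N + 1) ^ Fintype.card κ := by
  classical
  rcases G.eq_empty_or_nonempty with rfl | ⟨q₀, hq₀⟩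
  · simp
  let bucket : ι → κ → ℤ := fun q i => ⌊inner ℝ (y q - y q₀) (τ q i) / δ⌋
  let colours : Finset ((E × (κ → E)) × (κ → ℤ)) :=
    (T ×ˢ Fintype.piFinset fun _ => T) ×ˢ Fintype.piFinset fun _ => Finset.Icc (-N : ℤ) N
  have hcolours : colours.card =
      T.card * T.card ^ Fintype.card κ * (2 * N + 1) ^ Fintype.card κ := by
    have hIcc : ((N : ℤ) + 1 - -N).toNat = 2 * N + 1 := by omega
    simp only [colours, Finset.card_product, Fintype.card_piFinset, Finset.prod_const,
      Finset.card_univ, Int.card_Icc, hIcc]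
  rw [← hcolours]
  refine Finset.card_le_card_of_injOn (fun q => ((t q, τ q), bucket q)) (fun q hq => ?_) ?_
  · simp only [colours, SetLike.mem_coe, Finset.mem_product, Fintype.mem_piFinset]
    exact ⟨⟨ht q hq, hτ q hq⟩, fun i =>
      floor_inner_div_mem_Icc hδ (hN q₀ hq₀ q hq) (hT _ (hτ q hq i))⟩
  · intro q hq q' hq' hcolour
    obtain ⟨⟨htt, hττ⟩, hbucket⟩ : (t q = t q' ∧ τ q = τ q') ∧ bucket q = bucket q' := by
      simpa only [Prod.mk.injEq] using hcolour
    by_contra hne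
    have hclose : ∀ i, |inner ℝ (y q' - y q) (τ q i)| ≤ δ := fun i => by
      have hfloor := (Int.abs_sub_lt_one_of_floor_eq_floor (congrFun hbucket.symm i)).le
      rwa [← hττ, ← sub_div, ← inner_sub_left, sub_sub_sub_cancel_right, abs_div,
        abs_of_pos hδ, div_le_one hδ] at hfloor
    have hclose' : ∀ i, |inner ℝ (y q - y q') (τ q' i)| ≤ δ := fun i => by
      rw [← hττ, ← neg_sub, inner_neg_left, abs_neg]
      exact hclose i
    have hqq' := hpos q hq q' hq' hne hclose
    have hq'q := hpos q' hq' q hq (Ne.symm hne) hclose'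
    rw [← htt, ← neg_sub, inner_neg_left] at hq'q
    linarith

theorem exists_finset_forall_norm_sub_le [FiniteDimensional ℝ E] {ε : ℝ} (hε : 0 < ε) :
    ∃ T : Finset E, (∀ τ ∈ T, ‖τ‖ ≤ 1) ∧ ∀ v : E, ‖v‖ = 1 → ∃ τ ∈ T, ‖v - τ‖ ≤ ε := by
  have := FiniteDimensional.proper_real E
  obtain ⟨T, hTsphere, hTfin, hcover⟩ := (isCompact_sphere (0 : E) 1).finite_cover_balls hε
  refine ⟨hTfin.toFinset, fun τ hτ => ?_, fun v hv => ?_⟩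
  · exact (mem_sphere_zero_iff_norm.1 (hTsphere (hTfin.mem_toFinset.1 hτ))).le
  · obtain ⟨τ, hτ, hvτ⟩ := Set.mem_iUnion₂.1 (hcover (mem_sphere_zero_iff_norm.2 hv))
    exact ⟨τ, hTfin.mem_toFinset.2 hτ, (mem_ball_iff_norm.1 hvτ).le⟩

end Directions

section Cones

theorem exists_unit_normals {n m : ℕ} (hm : m ≤ n) {V : Submodule ℝ (Rn n)}
    (hV : V ∈ grassmannian n (n - m)) :
    ∃ v : Fin m → Rn n, (∀ i, ‖v i‖ = 1) ∧
      ∀ w, Metric.infDist w (V : Set (Rn n)) ≤ ∑ i, |inner ℝ w (v i)| := by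
  have hfinrank : Module.finrank ℝ Vᗮ = m := by
    have hsum := V.finrank_add_finrank_orthogonal
    rw [show Module.finrank ℝ V = n - m from hV, finrank_euclideanSpace_fin] at hsum
    omega
  let b := (stdOrthonormalBasis ℝ Vᗮ).reindex (finCongr hfinrank)
  refine ⟨fun i => b i, b.orthonormal.1, fun w => ?_⟩
  have hproj : w - V.starProjection w = (Vᗮ.orthogonalProjectionOnto w : Rn n) := by
    rw [← Submodule.starProjection_orthogonal_val]
    rfl
  calc Metric.infDist w (V : Set (Rn n)) ≤ dist w (V.starProjection w) :=
        Metric.infDist_le_dist_of_mem (V.starProjection_apply_mem w)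
    _ = ‖∑ i, b.repr (Vᗮ.orthogonalProjectionOnto w) i • b i‖ := by
        rw [dist_eq_norm, hproj, b.sum_repr, Submodule.norm_coe]
    _ ≤ ∑ i, ‖b.repr (Vᗮ.orthogonalProjectionOnto w) i • b i‖ := norm_sum_le _ _
    _ = ∑ i, |inner ℝ w (b i : Rn n)| := Finset.sum_congr rfl fun i _ => by
        rw [norm_smul, b.orthonormal.1 i, mul_one, b.repr_apply_apply, Real.norm_eq_abs,
          real_inner_comm, Submodule.inner_orthogonalProjectionOnto_eq_of_mem_right]

variable {n m : ℕ} {α ε δ : ℝ} {y y' z : Rn n}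

theorem mem_cone_of_forall_abs_inner_le (hα : 2 * (m + 1) * ε ≤ α) (hε : 0 < ε)
    {V : Submodule ℝ (Rn n)} {v τ : Fin m → Rn n}
    (hv : ∀ w, Metric.infDist w (V : Set (Rn n)) ≤ ∑ i, |inner ℝ w (v i)|)
    (hvτ : ∀ i, ‖v i - τ i‖ ≤ ε) (hτ : ∀ i, ‖τ i‖ ≤ 1) (hz : ‖z - y'‖ ≤ δ)
    (hδ : 2 * δ ≤ ε * ‖z - y‖) (hzy : 0 < ‖z - y‖) (hy : ∀ i, |inner ℝ (y' - y) (τ i)| ≤ δ) :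
    z ∈ cone y V α := by
  have hinner : ∀ i, |inner ℝ (z - y) (v i)| ≤ 2 * ε * ‖z - y‖ := fun i => by
    have hdiff := abs_inner_sub_inner_le (hvτ i) (hτ i)
      (show ‖(z - y) - (y' - y)‖ ≤ δ by rwa [sub_sub_sub_cancel_right])
    linarith [abs_sub_abs_le_abs_sub (inner ℝ (z - y) (v i)) (inner ℝ (y' - y) (τ i)), hy i]
  calc Metric.infDist (z - y) (V : Set (Rn n)) ≤ ∑ i, |inner ℝ (z - y) (v i)| := hv _
    _ ≤ ∑ _i : Fin m, 2 * ε * ‖z - y‖ := Finset.sum_le_sum fun i _ => hinner i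
    _ = 2 * m * ε * ‖z - y‖ := by
        rw [Finset.sum_const, Finset.card_univ, Fintype.card_fin, nsmul_eq_mul]
        ring
    _ < 2 * (m + 1) * ε * ‖z - y‖ := by gcongr; linarith
    _ ≤ α * ‖z - y‖ := by gcongr

theorem inner_pos_of_mem_H (hα : 2 * ε ≤ α) {θ t : Rn n} (hθ : ‖θ - t‖ ≤ ε) (ht : ‖t‖ ≤ 1)
    (hz : ‖z - y'‖ ≤ δ) (hδ : 2 * δ ≤ ε * ‖z - y‖) (hH : z ∈ H y θ α) :
    0 < inner ℝ (y' - y) t := by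
  have hdiff := (le_abs_self _).trans (abs_inner_sub_inner_le hθ ht
    (show ‖(z - y) - (y' - y)‖ ≤ δ by rwa [sub_sub_sub_cancel_right]))
  have hzθ : α * ‖z - y‖ < inner ℝ (z - y) θ := hH
  have hαε : 2 * ε * ‖z - y‖ ≤ α * ‖z - y‖ := by gcongr
  linarith [(norm_nonneg _).trans hz]

theorem exists_mem_forall_inner_pos (hm : m ≤ n) (hε : 0 < ε) (hα : 2 * (m + 1) * ε ≤ α)
    (hδ : 0 < δ) {T : Finset (Rn n)} (hT : ∀ τ ∈ T, ‖τ‖ ≤ 1)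
    (hnet : ∀ v : Rn n, ‖v‖ = 1 → ∃ τ ∈ T, ‖v - τ‖ ≤ ε) {θ : Rn n} (hθ : θ ∈ unitSphere n)
    {V : Submodule ℝ (Rn n)} (hV : V ∈ grassmannian n (n - m)) (y : Rn n) :
    ∃ t ∈ T, ∃ τ : Fin m → Rn n, (∀ i, τ i ∈ T) ∧ ∀ y' z, z ∉ cone y V α \ H y θ α →
      ‖z - y'‖ ≤ δ → 2 * δ ≤ ε * ‖z - y‖ → (∀ i, |inner ℝ (y' - y) (τ i)| ≤ δ) →
        0 < inner ℝ (y' - y) t := by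
  obtain ⟨v, hvnorm, hv⟩ := exists_unit_normals hm hV
  obtain ⟨t, htT, hθt⟩ := hnet θ (mem_sphere_zero_iff_norm.1 hθ)
  choose τ hτT hvτ using fun i => hnet (v i) (hvnorm i)
  refine ⟨t, htT, τ, hτT, fun y' z hz hzy' hzδ hy' => ?_⟩
  have hzy : 0 < ‖z - y‖ := pos_of_mul_pos_right ((by positivity : 0 < 2 * δ).trans_le hzδ) hε.le
  have hcone : z ∈ cone y V α := mem_cone_of_forall_abs_inner_le hα hε hv hvτ
    (fun i => hT _ (hτT i)) hzy' hzδ hzy hy'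
  have hα' : 2 * ε ≤ α := le_trans (by nlinarith [m.cast_nonneg (α := ℝ)]) hα
  exact inner_pos_of_mem_H hα' hθt (hT t htT) hzy' hzδ (by_contra fun hH => hz ⟨hcone, hH⟩)

theorem exists_card_le_of_not_subset_cone (ι : Type*) (hm : m ≤ n) (hα : 0 < α) :
    ∃ C L : ℕ, ∀ (G : Finset ι) (Q : ι → Set (Rn n)) (δ : ℝ) (N : ℕ), 0 < δ →
      (∀ q ∈ G, ∀ y ∈ Q q, ∀ z ∈ Q q, ‖z - y‖ ≤ δ) →
      (∀ q ∈ G, ∀ q' ∈ G, q ≠ q' → ∀ y ∈ Q q, ∀ z ∈ Q q', L * δ ≤ ‖z - y‖) →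
      (∀ q ∈ G, ∀ q' ∈ G, ∀ y ∈ Q q, ∀ z ∈ Q q', ‖z - y‖ ≤ N * δ) →
      (∀ q ∈ G, ∃ y ∈ Q q, ∃ θ ∈ unitSphere n, ∃ V ∈ grassmannian n (n - m),
        ∀ q' ∈ G, ¬ Q q' ⊆ cone y V α \ H y θ α) →
      G.card ≤ C * (2 * N + 1) ^ m := by
  obtain ⟨ε, hε, hεα⟩ : ∃ ε > 0, 2 * (m + 1) * ε ≤ α :=
    ⟨α / (2 * (m + 1)), by positivity, by field_simp; rfl⟩
  obtain ⟨L, hL⟩ := exists_nat_ge (2 / ε)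
  rw [div_le_iff₀' hε] at hL
  obtain ⟨T, hT, hnet⟩ := exists_finset_forall_norm_sub_le (E := Rn n) hε
  refine ⟨T.card * T.card ^ m, L, fun G Q δ N hδ hdiam hsep hN hQ => ?_⟩
  choose! y hyQ θ hθ V hV hnot using hQ
  choose! t htT τ hτT hpos using fun q hq =>
    exists_mem_forall_inner_pos hm hε hεα hδ hT hnet (hθ q hq) (hV q hq) (y q)
  have hcard := card_le_of_forall_inner_pos hT htT hτT hδ
    (fun q hq q' hq' => hN q hq q' hq' _ (hyQ q hq) _ (hyQ q' hq')) fun q hq q' hq' hne hclose => by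
      obtain ⟨z, hzQ, hz⟩ := Set.not_subset.1 (hnot q hq q' hq')
      refine hpos q hq (y q') z hz (hdiam q' hq' _ (hyQ q' hq') z hzQ) ?_ hclose
      calc 2 * δ ≤ ε * L * δ := by gcongr
        _ = ε * (L * δ) := mul_assoc _ _ _
        _ ≤ ε * ‖z - y q‖ := by gcongr; exact hsep q hq q' hq' hne _ (hyQ q hq) z hzQ
  simpa only [Fintype.card_fin] using hcard

end Cones

section Grid

variable {n : ℕ}

/-- The index of the cube containing `x` in the grid of half-open cubes of side length `B⁻ᵏ`. -/
noncomputable def cubeIndex (B k : ℕ) (x : Rn n) : Fin n → ℤ := fun i => ⌊x i * (B : ℝ) ^ k⌋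

/-- The half-open cube of side length `B⁻ᵏ` with index `q`. -/
noncomputable def cube (B k : ℕ) (q : Fin n → ℤ) : Set (Rn n) := cubeIndex B k ⁻¹' {q}

/-- The index of the cube of side length `B⁻ᵏ` containing the cube of side length `B⁻⁽ᵏ⁺¹⁾` with
index `q`. It does not depend on `k`. -/
noncomputable def parentIndex (B : ℕ) (q : Fin n → ℤ) : Fin n → ℤ := fun i => q i / B

/-- The indices of the subcubes of side length `B⁻⁽ᵏ⁺¹⁾` of the cube of side length `B⁻ᵏ` with
index `p`, for any `k`. -/
noncomputable def childIndices (B : ℕ) (p : Fin n → ℤ) : Finset (Fin n → ℤ) :=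
  Fintype.piFinset fun i => Finset.Ico (B * p i) (B * p i + B)

/-- The indices differing from `p` by at most `n` in each coordinate. -/
noncomputable def nearIndices (p : Fin n → ℤ) : Finset (Fin n → ℤ) :=
  Fintype.piFinset fun i => Finset.Icc (p i - n) (p i + n)

/-- The union of the cubes of side length `B⁻ᵏ` whose indices differ from `p` by at most `n` in
each coordinate: a neighbourhood of the cube with index `p` by a fixed multiple of its size. -/
noncomputable def nearCubes (B k : ℕ) (p : Fin n → ℤ) : Set (Rn n) :=
  cubeIndex B k ⁻¹' nearIndices p

variable {B k : ℕ}

theorem mem_childIndices (hB : 0 < B) {p q : Fin n → ℤ} :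
    q ∈ childIndices B p ↔ parentIndex B q = p := by
  rw [funext_iff, childIndices, Fintype.mem_piFinset]
  refine forall_congr' fun i => ?_
  rw [Finset.mem_Ico, parentIndex, Int.ediv_eq_iff_of_pos (by exact_mod_cast hB)]
  constructor <;> rintro ⟨hlower, hupper⟩ <;> constructor <;> linarith

theorem card_childIndices (B : ℕ) (p : Fin n → ℤ) : (childIndices B p).card = B ^ n := by
  simp [childIndices]

theorem card_nearIndices (p : Fin n → ℤ) : (nearIndices p).card = (2 * n + 1) ^ n := by
  have hIcc : ∀ i, (Finset.Icc (p i - n) (p i + n)).card = 2 * n + 1 := fun i => by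
    rw [Int.card_Icc]
    omega
  simp [nearIndices, hIcc]

theorem mem_nearIndices {p q : Fin n → ℤ} : q ∈ nearIndices p ↔ ∀ i, |q i - p i| ≤ n := by
  simp only [nearIndices, Fintype.mem_piFinset, Finset.mem_Icc, abs_sub_le_iff]
  exact forall_congr' fun i => by omega

theorem mem_nearIndices_comm {p q : Fin n → ℤ} : q ∈ nearIndices p ↔ p ∈ nearIndices q := by
  simp only [mem_nearIndices, abs_sub_comm]

theorem parentIndex_cubeIndex_succ (hB : 0 < B) (k : ℕ) (x : Rn n) :
    parentIndex B (cubeIndex B (k + 1) x) = cubeIndex B k x := by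
  funext i
  rw [parentIndex, cubeIndex, cubeIndex, pow_succ, ← mul_assoc,
    Int.mul_natCast_floor_div_cancel hB.ne']

theorem cubeIndex_succ_mem_childIndices (hB : 0 < B) (k : ℕ) (x : Rn n) :
    cubeIndex B (k + 1) x ∈ childIndices B (cubeIndex B k x) :=
  (mem_childIndices hB).2 (parentIndex_cubeIndex_succ hB k x)

theorem cube_succ_subset_cube_parentIndex (hB : 0 < B) (k : ℕ) (q : Fin n → ℤ) :
    cube B (k + 1) q ⊆ cube B k (parentIndex B q) := by
  rintro x rfl
  exact (parentIndex_cubeIndex_succ hB k x).symm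

theorem measurable_cubeIndex (B k : ℕ) : Measurable (cubeIndex (n := n) B k) :=
  measurable_pi_lambda _ fun i => Int.measurable_floor.comp (by fun_prop)

theorem measurableSet_cube (B k : ℕ) (q : Fin n → ℤ) : MeasurableSet (cube B k q) :=
  measurable_cubeIndex B k (measurableSet_singleton q)

theorem measurableSet_nearCubes (B k : ℕ) (p : Fin n → ℤ) : MeasurableSet (nearCubes B k p) :=
  measurable_cubeIndex B k (nearIndices p).measurableSet

theorem norm_le_of_forall_abs_le {x : Rn n} {d : ℝ} (hd : 0 ≤ d) (h : ∀ i, |x i| ≤ d) :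
    ‖x‖ ≤ n * d := by
  rw [EuclideanSpace.norm_eq]
  refine Real.sqrt_le_iff.2 ⟨by positivity, ?_⟩
  calc ∑ i, ‖x i‖ ^ 2 ≤ ∑ _i : Fin n, d ^ 2 := by
        gcongr with i
        exact h i
    _ = n * d ^ 2 := by simp
    _ ≤ (n * d) ^ 2 := by
        rw [mul_pow]
        gcongr
        exact_mod_cast Nat.le_self_pow two_ne_zero n

theorem abs_abs_cubeIndex_sub_lt_one (B k : ℕ) (x y : Rn n) (i : Fin n) :
    |((|cubeIndex B k x i - cubeIndex B k y i| : ℤ) : ℝ) - |(x - y) i| * (B : ℝ) ^ k| < 1 := by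
  have hfract : ((cubeIndex B k x i - cubeIndex B k y i : ℤ) : ℝ) - (x - y) i * (B : ℝ) ^ k =
      Int.fract (y i * (B : ℝ) ^ k) - Int.fract (x i * (B : ℝ) ^ k) := by
    simp only [cubeIndex, Int.fract, PiLp.sub_apply]
    push_cast
    ring
  calc |((|cubeIndex B k x i - cubeIndex B k y i| : ℤ) : ℝ) - |(x - y) i| * (B : ℝ) ^ k|
      = |(|((cubeIndex B k x i - cubeIndex B k y i : ℤ) : ℝ)| - |(x - y) i * (B : ℝ) ^ k|)| := by
        rw [Int.cast_abs, abs_mul, abs_of_nonneg (by positivity : (0 : ℝ) ≤ (B : ℝ) ^ k)]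
    _ ≤ |((cubeIndex B k x i - cubeIndex B k y i : ℤ) : ℝ) - (x - y) i * (B : ℝ) ^ k| :=
        abs_abs_sub_abs_le_abs_sub _ _
    _ < 1 := by
        rw [hfract, abs_lt]
        constructor <;> linarith [Int.fract_nonneg (x i * (B : ℝ) ^ k),
          Int.fract_lt_one (x i * (B : ℝ) ^ k), Int.fract_nonneg (y i * (B : ℝ) ^ k),
          Int.fract_lt_one (y i * (B : ℝ) ^ k)]

theorem norm_sub_le_of_mem_cube (hB : 0 < B) {q : Fin n → ℤ} {x y : Rn n} (hx : x ∈ cube B k q)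
    (hy : y ∈ cube B k q) : ‖x - y‖ ≤ n * ((B : ℝ) ^ k)⁻¹ := by
  refine norm_le_of_forall_abs_le (by positivity) fun i => ?_
  have hi := (abs_lt.1 (abs_abs_cubeIndex_sub_lt_one B k x y i)).1
  rw [show cubeIndex B k x = cubeIndex B k y from hx.trans hy.symm, sub_self, abs_zero,
    Int.cast_zero] at hi
  rw [← one_div, le_div_iff₀ (by positivity)]
  linarith

theorem norm_sub_le_of_mem_childIndices (hB : 0 < B) {p q q' : Fin n → ℤ}
    (hq : q ∈ childIndices B p) (hq' : q' ∈ childIndices B p) {x y : Rn n}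
    (hx : x ∈ cube B (k + 1) q) (hy : y ∈ cube B (k + 1) q') :
    ‖y - x‖ ≤ n * ((B : ℝ) ^ k)⁻¹ := by
  have hxp := cube_succ_subset_cube_parentIndex hB k q hx
  have hyp := cube_succ_subset_cube_parentIndex hB k q' hy
  rw [(mem_childIndices hB).1 hq] at hxp
  rw [(mem_childIndices hB).1 hq'] at hyp
  exact norm_sub_le_of_mem_cube hB hyp hxp

theorem closedBall_subset_nearCubes (hB : 0 < B) (k : ℕ) (x : Rn n) :
    Metric.closedBall x (n * ((B : ℝ) ^ k)⁻¹) ⊆ nearCubes B k (cubeIndex B k x) := fun y hy =>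
  mem_nearIndices.2 fun i => by
    have hyx : |(y - x) i| ≤ n * ((B : ℝ) ^ k)⁻¹ :=
      (PiLp.norm_apply_le (y - x) i).trans (mem_closedBall_iff_norm.1 hy)
    rw [← div_eq_mul_inv, le_div_iff₀ (by positivity)] at hyx
    have hi := (abs_lt.1 (abs_abs_cubeIndex_sub_lt_one B k y x i)).2
    have hlt : ((|cubeIndex B k y i - cubeIndex B k x i| : ℤ) : ℝ) < n + 1 := by linarith
    exact Int.lt_add_one_iff.1 (by exact_mod_cast hlt)

theorem nearCubes_subset_closedBall (hB : 0 < B) (k : ℕ) (x : Rn n) :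
    nearCubes B k (cubeIndex B k x) ⊆ Metric.closedBall x (n * ((n + 1) * ((B : ℝ) ^ k)⁻¹)) := by
  intro y hy
  refine mem_closedBall_iff_norm.2 (norm_le_of_forall_abs_le (by positivity) fun i => ?_)
  have hyx : ((|cubeIndex B k y i - cubeIndex B k x i| : ℤ) : ℝ) ≤ n := by
    exact_mod_cast mem_nearIndices.1 hy i
  have hi := (abs_lt.1 (abs_abs_cubeIndex_sub_lt_one B k y x i)).1
  rw [← div_eq_mul_inv, le_div_iff₀ (by positivity)]
  linarith

theorem nearCubes_subset_cthickening (hB : 0 < B) {K : Set (Rn n)} {x : Rn n} (hx : x ∈ K) {δ : ℝ}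
    (hδ : n * (n + 1) * ((B : ℝ) ^ k)⁻¹ ≤ δ) :
    nearCubes B k (cubeIndex B k x) ⊆ Metric.cthickening δ K := by
  rw [mul_assoc] at hδ
  exact ((nearCubes_subset_closedBall hB k x).trans (Metric.closedBall_subset_closedBall hδ)).trans
    (Metric.closedBall_subset_cthickening hx δ)

theorem mul_le_norm_sub_of_forall_intCast_eq (hB : 0 < B) {L : ℕ} {q q' : Fin n → ℤ}
    (hne : q ≠ q') (hmod : ∀ i, (q i : ZMod (L + 1)) = q' i) {y z : Rn n} (hy : y ∈ cube B k q)
    (hz : z ∈ cube B k q') : L * ((B : ℝ) ^ k)⁻¹ ≤ ‖z - y‖ := by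
  obtain ⟨i, hi⟩ := Function.ne_iff.1 hne
  have hdvd : ((L + 1 : ℕ) : ℤ) ∣ q' i - q i :=
    (ZMod.intCast_eq_intCast_iff_dvd_sub _ _ _).1 (hmod i)
  have hle : ((L + 1 : ℕ) : ℤ) ≤ |q' i - q i| :=
    Int.le_of_dvd (abs_pos.2 (sub_ne_zero.2 hi.symm)) ((dvd_abs _ _).2 hdvd)
  have hle' : (L : ℝ) + 1 ≤ (|q' i - q i| : ℤ) := by exact_mod_cast hle
  have hzy := (abs_lt.1 (abs_abs_cubeIndex_sub_lt_one B k z y i)).2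
  rw [show cubeIndex B k z = q' from hz, show cubeIndex B k y = q from hy] at hzy
  refine le_trans ?_ (PiLp.norm_apply_le (z - y) i)
  rw [← div_eq_mul_inv, div_le_iff₀ (by positivity), Real.norm_eq_abs]
  linarith

theorem exists_finset_cubeIndex_mem {K : Set (Rn n)} (hK : Bornology.IsBounded K) (B k : ℕ) :
    ∃ F : Finset (Fin n → ℤ), ∀ x ∈ K, cubeIndex B k x ∈ F := by
  obtain ⟨R, hR⟩ := hK.exists_norm_le
  refine ⟨Fintype.piFinset fun _ => Finset.Icc ⌊-R * (B : ℝ) ^ k⌋ ⌊R * (B : ℝ) ^ k⌋,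
    fun x hx => Fintype.mem_piFinset.2 fun i => ?_⟩
  obtain ⟨hlower, hupper⟩ := abs_le.1 ((PiLp.norm_apply_le x i).trans (hR x hx))
  exact Finset.mem_Icc.2 ⟨Int.floor_le_floor (by gcongr), Int.floor_le_floor (by gcongr)⟩

theorem exists_card_le_of_not_subset_truncCone {m : ℕ} (hm : m < n) {α : ℝ} (hα : 0 < α) :
    ∃ C : ℕ, ∀ (B k : ℕ) (p : Fin n → ℤ), 0 < B → ∀ G ⊆ childIndices B p,
      (∀ q ∈ G, ∃ y ∈ cube B (k + 1) q, ∃ θ ∈ unitSphere n, ∃ V ∈ grassmannian n (n - m),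
        ∀ q' ∈ G, ¬ cube B (k + 1) q' ⊆ truncCone y (n * ((B : ℝ) ^ k)⁻¹) V α \ H y θ α) →
      G.card ≤ C * B ^ m := by
  classical
  obtain ⟨C, L, hCL⟩ := exists_card_le_of_not_subset_cone (Fin n → ℤ) hm.le hα
  refine ⟨C * 3 ^ m * (L * n + 1) ^ n, fun B k p hB G hGp hG => ?_⟩
  let residue : (Fin n → ℤ) → Fin n → ZMod (L * n + 1) := fun q i => q i
  have hclass : ∀ a, {q ∈ G | residue q = a}.card ≤ C * (2 * B + 1) ^ m := fun a => by
    refine hCL _ (cube B (k + 1)) (n * ((B : ℝ) ^ (k + 1))⁻¹) B ?_ ?_ ?_ ?_ ?_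
    · have : 0 < n := m.zero_le.trans_lt hm
      positivity
    · exact fun q _ y hy z hz => norm_sub_le_of_mem_cube hB hz hy
    · intro q hq q' hq' hne y hy z hz
      have hmod : residue q = residue q' :=
        (Finset.mem_filter.1 hq).2.trans (Finset.mem_filter.1 hq').2.symm
      simpa only [Nat.cast_mul, mul_assoc] using
        mul_le_norm_sub_of_forall_intCast_eq hB hne (congrFun hmod) hy hz
    · intro q hq q' hq' y hy z hz
      calc ‖z - y‖ ≤ n * ((B : ℝ) ^ k)⁻¹ := norm_sub_le_of_mem_childIndices hB
            (hGp (Finset.mem_filter.1 hq).1) (hGp (Finset.mem_filter.1 hq').1) hy hz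
        _ = B * (n * ((B : ℝ) ^ (k + 1))⁻¹) := by
            rw [pow_succ]
            field_simp
    · intro q hq
      have hqG := (Finset.mem_filter.1 hq).1
      obtain ⟨y, hy, θ, hθ, V, hV, hnot⟩ := hG q hqG
      refine ⟨y, hy, θ, hθ, V, hV, fun q' hq' hcone => ?_⟩
      have hqG' := (Finset.mem_filter.1 hq').1
      refine hnot q' hqG' fun z hz => ⟨⟨mem_closedBall_iff_norm.2 ?_, (hcone hz).1⟩, (hcone hz).2⟩
      exact norm_sub_le_of_mem_childIndices hB (hGp hqG) (hGp hqG') hy hz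
  calc G.card ≤ C * (2 * B + 1) ^ m * (G.image residue).card :=
        Finset.card_le_mul_card_image _ _ fun a _ => hclass a
    _ ≤ C * (3 * B) ^ m * (L * n + 1) ^ n := by
        gcongr
        · omega
        · refine (Finset.card_le_univ _).trans_eq ?_
          simp [ZMod.card]
    _ = C * 3 ^ m * (L * n + 1) ^ n * B ^ m := by
        rw [mul_pow]
        ring

end Grid

section HeavyAndLightCubes

variable {n : ℕ}

/-- The points at which, for some choice of cone and half-space, the cone of radius `r` with the
half-space removed carries at most the proportion `c` of the mass of the ball. -/
def IsThinAt (μ : Measure (Rn n)) (m : ℕ) (α : ℝ) (c : ℝ≥0∞) (r : ℝ) (x : Rn n) : Prop :=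
  ∃ θ ∈ unitSphere n, ∃ V ∈ grassmannian n (n - m),
    μ (truncCone x r V α \ H x θ α) ≤ c * μ (Metric.closedBall x r)

/-- The indices of the cubes of side length `B⁻⁽ᵏ⁺¹⁾` whose mass in `K` is at most the proportion
`c` of the mass of the neighbourhood `nearCubes` of their parent. -/
def lightCubes (μ : Measure (Rn n)) (K : Set (Rn n)) (c : ℝ≥0∞) (B k : ℕ) : Set (Fin n → ℤ) :=
  {q | μ (cube B (k + 1) q ∩ K) ≤ c * μ (nearCubes B k (parentIndex B q))}

open Classical in
theorem exists_card_heavy_children_le {m : ℕ} (hm : m < n) {α : ℝ} (hα : 0 < α) :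
    ∃ C : ℕ, ∀ (μ : Measure (Rn n)) (K S : Set (Rn n)) (c : ℝ≥0∞) (B k : ℕ), 0 < B →
      (∀ A, MeasurableSet A → μ (A ∩ K) ≠ 0 → (A ∩ S).Nonempty) →
      (∀ x ∈ S, IsThinAt μ m α c (n * ((B : ℝ) ^ k)⁻¹) x) →
      ∀ p, {q ∈ childIndices B p | q ∉ lightCubes μ K c B k}.card ≤ C * B ^ m := by
  obtain ⟨C, hC⟩ := exists_card_le_of_not_subset_truncCone hm hα
  refine ⟨C, fun μ K S c B k hB hKS hS p =>
    hC B k p hB _ (Finset.filter_subset _ _) fun q hq => ?_⟩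
  have hheavy : ∀ q ∈ {q ∈ childIndices B p | q ∉ lightCubes μ K c B k},
      c * μ (nearCubes B k p) < μ (cube B (k + 1) q ∩ K) := fun q hq => by
    obtain ⟨hqp, hq⟩ := Finset.mem_filter.1 hq
    rw [← (mem_childIndices hB).1 hqp]
    exact not_le.1 hq
  obtain ⟨y, hy, hyS⟩ := hKS _ (measurableSet_cube B (k + 1) q) (pos_of_gt (hheavy q hq)).ne'
  obtain ⟨θ, hθ, V, hV, hthin⟩ := hS y hyS
  have hyp : cubeIndex B k y = p := by
    rw [← (mem_childIndices hB).1 (Finset.mem_filter.1 hq).1]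
    exact cube_succ_subset_cube_parentIndex hB k q hy
  refine ⟨y, hy, θ, hθ, V, hV, fun q' hq' hsub => (hheavy q' hq').not_ge ?_⟩
  calc μ (cube B (k + 1) q' ∩ K) ≤ μ (truncCone y (n * ((B : ℝ) ^ k)⁻¹) V α \ H y θ α) :=
        measure_mono (Set.inter_subset_left.trans hsub)
    _ ≤ c * μ (Metric.closedBall y (n * ((B : ℝ) ^ k)⁻¹)) := hthin
    _ ≤ c * μ (nearCubes B k p) := by
        gcongr
        exact hyp ▸ closedBall_subset_nearCubes hB k y

variable {μ : Measure (Rn n)} {B k : ℕ}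

theorem tsum_measure_nearCubes_parentIndex_inter_le (hB : 0 < B) (U : Set (Rn n)) :
    ∑' q, μ (nearCubes B k (parentIndex B q) ∩ U) ≤ ((2 * n + 1) ^ n * B ^ n : ℕ) * μ U := by
  refine tsum_measure_inter_le_of_card_le (fun q => measurableSet_nearCubes B k _) U
    (fun x => (nearIndices (cubeIndex B k x)).biUnion (childIndices B)) (fun x q hx => ?_)
    fun x => ?_
  · exact Finset.mem_biUnion.2
      ⟨parentIndex B q, mem_nearIndices_comm.1 hx, (mem_childIndices hB).2 rfl⟩
  · rw [← card_nearIndices (cubeIndex B k x)]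
    exact Finset.card_biUnion_le_card_mul _ _ _ fun p _ => (card_childIndices B p).le

theorem measure_cubeIndex_mem_lightCubes_le {K U : Set (Rn n)} (c : ℝ≥0∞) (hB : 0 < B)
    (hKU : ∀ x ∈ K, nearCubes B k (cubeIndex B k x) ⊆ U) :
    μ {x ∈ K | cubeIndex B (k + 1) x ∈ lightCubes μ K c B k} ≤
      c * (((2 * n + 1) ^ n * B ^ n : ℕ) * μ U) := by
  let E : Set (Rn n) := {x ∈ K | cubeIndex B (k + 1) x ∈ lightCubes μ K c B k}
  have hcube : ∀ q, μ (E ∩ cube B (k + 1) q) ≤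
      c * μ (nearCubes B k (parentIndex B q) ∩ U) := fun q => by
    rcases (E ∩ cube B (k + 1) q).eq_empty_or_nonempty with hempty | ⟨x, ⟨hxK, hlight⟩, rfl⟩
    · simp [hempty]
    have hnear : nearCubes B k (parentIndex B (cubeIndex B (k + 1) x)) ⊆ U := by
      rw [parentIndex_cubeIndex_succ hB]
      exact hKU x hxK
    rw [Set.inter_eq_left.2 hnear]
    have hsub : E ∩ cube B (k + 1) (cubeIndex B (k + 1) x) ⊆
        cube B (k + 1) (cubeIndex B (k + 1) x) ∩ K := fun z hz => ⟨hz.2, hz.1.1⟩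
    exact (measure_mono hsub).trans hlight
  have hcover : E ⊆ ⋃ q, E ∩ cube B (k + 1) q := fun x hx =>
    Set.mem_iUnion.2 ⟨cubeIndex B (k + 1) x, hx, rfl⟩
  calc μ E ≤ ∑' q, μ (E ∩ cube B (k + 1) q) :=
        (measure_mono hcover).trans (measure_iUnion_le _)
    _ ≤ ∑' q, c * μ (nearCubes B k (parentIndex B q) ∩ U) := ENNReal.tsum_le_tsum hcube
    _ = c * ∑' q, μ (nearCubes B k (parentIndex B q) ∩ U) := ENNReal.tsum_mul_left
    _ ≤ c * (((2 * n + 1) ^ n * B ^ n : ℕ) * μ U) := by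
        gcongr
        exact tsum_measure_nearCubes_parentIndex_inter_le hB U

end HeavyAndLightCubes

section HausdorffDimension

variable {n : ℕ}

theorem ediam_cube_le {B : ℕ} (hB : 0 < B) (k : ℕ) (q : Fin n → ℤ) :
    Metric.ediam (cube B k q) ≤ n * ((B : ℝ≥0∞) ^ k)⁻¹ := by
  refine Metric.ediam_le fun x hx y hy => ?_
  calc edist x y = ENNReal.ofReal ‖x - y‖ := by rw [edist_dist, dist_eq_norm]
    _ ≤ ENNReal.ofReal (n * ((B : ℝ) ^ k)⁻¹) :=
        ENNReal.ofReal_le_ofReal (norm_sub_le_of_mem_cube hB hx hy)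
    _ = n * ((B : ℝ≥0∞) ^ k)⁻¹ := by
        rw [ENNReal.ofReal_mul n.cast_nonneg, ENNReal.ofReal_inv_of_pos (by positivity),
          ENNReal.ofReal_pow B.cast_nonneg, ENNReal.ofReal_natCast, ENNReal.ofReal_natCast]

/- Per block of `D` generations with one bad step, the number of paths grows by at most
`(N + 1) ^ D * B ^ n`, while the diameters shrink by `B ^ D`. -/
open Classical in
theorem dimH_frequently_count_le {K : Set (Rn n)} (hK : Bornology.IsBounded K) {B D N : ℕ}
    (hB : 0 < B) (k : ℕ) {bad : ℕ → Set (Fin n → ℤ)}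
    (hN : ∀ j p, {q ∈ childIndices B p | q ∉ bad j}.card ≤ N) {d : NNReal} (hd : 0 < d)
    (hrate : (((N + 1) ^ D * B ^ n : ℕ) : ℝ≥0∞) * (((B : ℝ≥0∞) ^ D)⁻¹) ^ (d : ℝ) < 1) :
    dimH {x ∈ K | ∃ᶠ l in atTop,
      Nat.count (fun j => cubeIndex B (k + j + 1) x ∈ bad j) (D * l) ≤ l} ≤ d := by
  obtain ⟨F₀, hF₀⟩ := exists_finset_cubeIndex_mem hK B k
  choose F hFcard hF using fun l => exists_card_le_of_count_le (childIndices B) bad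
    (Nat.pow_pos hB) (fun p => (card_childIndices B p).le) hN F₀ (D * l) l
  have hcard : ∀ l, ((F l).card : ℝ≥0∞) ≤ F₀.card * (((N + 1) ^ D * B ^ n : ℕ) : ℝ≥0∞) ^ l :=
    fun l => by
      have hl := hFcard l
      rw [pow_mul, mul_assoc, ← mul_pow] at hl
      exact_mod_cast hl
  have hdiam : ∀ l q, Metric.ediam (cube (n := n) B (k + D * l) q) ≤
      n * (((B : ℝ≥0∞) ^ D)⁻¹) ^ l := fun l q => by
    refine (ediam_cube_le hB _ q).trans ?_
    rw [← ENNReal.inv_pow, ← pow_mul]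
    gcongr
    · exact_mod_cast hB
    · omega
  have hnull := hausdorffMeasure_frequently_mem_eq_zero (NNReal.coe_pos.2 hd) F
    (ENNReal.natCast_ne_top F₀.card) (ENNReal.natCast_ne_top n) hrate hcard hdiam
  refine dimH_le_of_hausdorffMeasure_ne_top
    (ne_of_eq_of_ne (measure_mono_null ?_ hnull) ENNReal.zero_ne_top)
  exact fun x hx => hx.2.mono fun l hl => ⟨cubeIndex B (k + D * l) x,
    hF l (fun j => cubeIndex B (k + j) x) (hF₀ x hx.1)
      (fun j => cubeIndex_succ_mem_childIndices hB _ x) hl, rfl⟩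

open Classical in
theorem hausdorffDim_le_of_measure_bad_le {μ : Measure (Rn n)} [IsFiniteMeasureOnCompacts μ]
    {K : Set (Rn n)} (hK : IsCompact K) (hμK : μ K ≠ 0) {B D N : ℕ} (hB : 0 < B) (k : ℕ)
    {bad : ℕ → Set (Fin n → ℤ)} (hN : ∀ j p, {q ∈ childIndices B p | q ∉ bad j}.card ≤ N)
    {d : NNReal} (hd : 0 < d)
    (hrate : (((N + 1) ^ D * B ^ n : ℕ) : ℝ≥0∞) * (((B : ℝ≥0∞) ^ D)⁻¹) ^ (d : ℝ) < 1)
    {κ : ℝ≥0∞} (hκ : ∀ j, μ {x ∈ K | cubeIndex B (k + j + 1) x ∈ bad j} ≤ κ)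
    (hDκ : D * κ ≤ μ K / 2) : hausdorffDim μ ≤ d := by
  let E : ℕ → Set (Rn n) := fun j => cubeIndex B (k + j + 1) ⁻¹' bad j
  let Z : Set (Rn n) := {x | ∃ᶠ l in atTop, Nat.count (fun j => x ∈ E j) (D * l) ≤ l}
  have hE : ∀ j, MeasurableSet (E j) := fun j =>
    measurable_cubeIndex B (k + j + 1) (Set.to_countable (bad j)).measurableSet
  have : IsFiniteMeasure (μ.restrict K) := ⟨by
    rw [Measure.restrict_apply_univ]
    exact hK.measure_lt_top⟩
  have hhalf : μ K / 2 ≤ μ (K ∩ Z) := by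
    have hZ := half_measure_univ_le_measure_frequently_count_le (μ := μ.restrict K) hE (κ := κ)
      (D := D) (fun j => by
        rw [Measure.restrict_apply (hE j), Set.inter_comm]
        exact hκ j) (by rwa [Measure.restrict_apply_univ])
    rwa [Measure.restrict_apply_univ, Measure.restrict_apply' hK.measurableSet,
      Set.inter_comm] at hZ
  calc hausdorffDim μ ≤ dimH (K ∩ Z) := iInf₂_le_of_le (K ∩ Z)
        (hK.measurableSet.inter (measurableSet_frequently_count_le hE D))
        (iInf_le _ ((ENNReal.half_pos hμK).trans_le hhalf))
    _ ≤ d := dimH_frequently_count_le hK.isBounded hB k hN hd hrate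

theorem exists_mul_rpow_lt_one (C m n : ℕ) {d : ℝ} (hd : m < d) :
    ∃ B D : ℕ, 1 < B ∧ 0 < D ∧
      (((C * B ^ m + 1) ^ D * B ^ n : ℕ) : ℝ≥0∞) * (((B : ℝ≥0∞) ^ D)⁻¹) ^ d < 1 := by
  have hd₀ : 0 < d := m.cast_nonneg.trans_lt hd
  obtain ⟨D, hD⟩ := exists_nat_gt ((n + 1) / (d - m))
  have hDpos : (0 : ℝ) < D :=
    (div_nonneg (by positivity) (sub_nonneg.2 hd.le)).trans_lt hD
  rw [div_lt_iff₀ (sub_pos.2 hd)] at hD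
  obtain ⟨B, hB⟩ : ∃ B, B = (C + 1) ^ D + 1 := ⟨_, rfl⟩
  have hB₁ : 1 < B := by rw [hB]; exact Nat.lt_add_of_pos_left (by positivity)
  refine ⟨B, D, hB₁, Nat.cast_pos.1 hDpos, ?_⟩
  have hnat : (C * B ^ m + 1) ^ D * B ^ n < B ^ (m * D + n + 1) :=
    calc (C * B ^ m + 1) ^ D * B ^ n ≤ ((C + 1) * B ^ m) ^ D * B ^ n := by
          gcongr
          rw [add_mul, one_mul]
          gcongr
          exact Nat.one_le_pow _ _ (by positivity)
      _ = (C + 1) ^ D * B ^ (m * D + n) := by rw [mul_pow, ← pow_mul, mul_assoc, ← pow_add]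
      _ < B * B ^ (m * D + n) := by gcongr; omega
      _ = B ^ (m * D + n + 1) := by ring
  have hlt : (((C * B ^ m + 1) ^ D * B ^ n : ℕ) : ℝ≥0∞) < ((B : ℝ≥0∞) ^ D) ^ d :=
    calc (((C * B ^ m + 1) ^ D * B ^ n : ℕ) : ℝ≥0∞) < ((B ^ (m * D + n + 1) : ℕ) : ℝ≥0∞) :=
          Nat.cast_lt.2 hnat
      _ = (B : ℝ≥0∞) ^ ((m * D + n + 1 : ℕ) : ℝ) := by rw [ENNReal.rpow_natCast, Nat.cast_pow]
      _ ≤ (B : ℝ≥0∞) ^ (D * d) := by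
          refine ENNReal.rpow_le_rpow_of_exponent_le (by exact_mod_cast hB₁.le) ?_
          push_cast
          linarith
      _ = ((B : ℝ≥0∞) ^ D) ^ d := by rw [ENNReal.rpow_mul, ENNReal.rpow_natCast]
  rw [ENNReal.inv_rpow, ← div_eq_mul_inv]
  refine (ENNReal.div_lt_iff (.inl (pos_of_gt hlt).ne') (.inl ?_)).2 (by rwa [one_mul])
  exact ENNReal.rpow_ne_top_of_nonneg hd₀.le (by finiteness)

theorem exists_forall_ge_mul_inv_pow_lt {B : ℝ} (hB : 1 < B) (a : ℝ) {r : ℝ} (hr : 0 < r) :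
    ∃ k : ℕ, ∀ j ≥ k, a * (B ^ j)⁻¹ < r := by
  have hlim : Tendsto (fun j : ℕ => a * (B ^ j)⁻¹) atTop (𝓝 0) := by
    simpa only [mul_zero, inv_pow] using (tendsto_pow_atTop_nhds_zero_of_lt_one
      (inv_nonneg.2 (zero_le_one.trans hB.le)) (inv_lt_one_of_one_lt₀ hB)).const_mul a
  exact eventually_atTop.1 (hlim.eventually_lt_const hr)

theorem mul_inv_mul_le_half (a b : ℕ) {u v : ℝ≥0∞} (h : u ≤ 2 * v) :
    a * (((4 * a * b : ℕ) : ℝ≥0∞)⁻¹ * (b * u)) ≤ v / 2 := by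
  have hv : 2 * v = 4 * (v / 2) := by
    rw [show (4 : ℝ≥0∞) = 2 * 2 by norm_num, mul_assoc,
      ENNReal.mul_div_cancel two_ne_zero ENNReal.ofNat_ne_top]
  calc a * (((4 * a * b : ℕ) : ℝ≥0∞)⁻¹ * (b * u))
      ≤ a * (((4 * a * b : ℕ) : ℝ≥0∞)⁻¹ * (b * (4 * (v / 2)))) := by
        gcongr
        exact h.trans_eq hv
    _ = (4 * a * b : ℕ) * ((4 * a * b : ℕ) : ℝ≥0∞)⁻¹ * (v / 2) := by
        push_cast
        ring
    _ ≤ v / 2 := mul_le_of_le_one_left zero_le (ENNReal.mul_inv_le_one _)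

theorem exists_hausdorffDim_le_of_isThinAt {m : ℕ} (hm : m < n) {α : ℝ} (hα : 0 < α)
    {d : NNReal} (hd : (m : ℝ) < d) :
    ∃ c : ℝ≥0∞, c ≠ 0 ∧ c ≠ ⊤ ∧ ∀ (μ : Measure (Rn n)) [IsLocallyFiniteMeasure μ],
      μ {x | ∀ᶠ r in 𝓝[>] 0, IsThinAt μ m α c r x} ≠ 0 → hausdorffDim μ ≤ d := by
  classical
  have hn : (0 : ℝ) < n := Nat.cast_pos.2 (m.zero_le.trans_lt hm)
  obtain ⟨C, hC⟩ := exists_card_heavy_children_le hm hα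
  obtain ⟨B, D, hB, hD, hrate⟩ := exists_mul_rpow_lt_one C m n hd
  have hB₀ : 0 < B := one_pos.trans hB
  let M : ℕ := (2 * n + 1) ^ n * B ^ n
  let c : ℝ≥0∞ := ((4 * D * M : ℕ) : ℝ≥0∞)⁻¹
  refine ⟨c, ENNReal.inv_ne_zero.2 (ENNReal.natCast_ne_top _),
    ENNReal.inv_ne_top.2 (Nat.cast_ne_zero.2 (by positivity)), fun μ _ hμ => ?_⟩
  obtain ⟨r₀, hr₀, hS⟩ := exists_measure_ne_zero_of_eventually_nhdsGT hμ
  obtain ⟨K, hK, hμK, hKS⟩ := exists_isCompact_forall_inter_nonempty hS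
  obtain ⟨δ, hδ, hδK⟩ := exists_measure_cthickening_lt_two_mul hK hμK
  obtain ⟨k, hk⟩ := exists_forall_ge_mul_inv_pow_lt (Nat.one_lt_cast.2 hB) (n * (n + 1))
    (lt_min hr₀ hδ)
  let bad : ℕ → Set (Fin n → ℤ) := fun j => lightCubes μ K c B (k + j)
  have hN : ∀ j p, {q ∈ childIndices B p | q ∉ bad j}.card ≤ C * B ^ m := fun j =>
    hC μ K _ c B (k + j) hB₀ hKS fun x hx => hx _ (by positivity) <|
      calc (n : ℝ) * ((B : ℝ) ^ (k + j))⁻¹ ≤ n * (n + 1) * ((B : ℝ) ^ (k + j))⁻¹ := by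
            gcongr
            nlinarith
        _ < r₀ := (hk _ le_self_add).trans_le (min_le_left _ _)
  have hlight : ∀ j, μ {x ∈ K | cubeIndex B (k + j + 1) x ∈ bad j} ≤
      c * (M * μ (Metric.cthickening δ K)) := fun j =>
    measure_cubeIndex_mem_lightCubes_le c hB₀ fun x hx =>
      nearCubes_subset_cthickening hB₀ hx ((hk _ le_self_add).le.trans (min_le_right _ _))
  exact hausdorffDim_le_of_measure_bad_le hK hμK hB₀ k hN
    (NNReal.coe_pos.1 (m.cast_nonneg.trans_lt hd)) hrate hlight
    (mul_inv_mul_le_half D M hδK.le)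

theorem isThinAt_of_iInf_lt {m : ℕ} {μ : Measure (Rn n)} [IsLocallyFiniteMeasure μ] {α r : ℝ}
    {c : ℝ≥0∞} {x : Rn n}
    (h : ⨅ θ ∈ unitSphere n, ⨅ V ∈ grassmannian n (n - m),
      μ (truncCone x r V α \ H x θ α) / μ (Metric.closedBall x r) < c) :
    IsThinAt μ m α c r x := by
  simp only [iInf_lt_iff] at h
  obtain ⟨θ, hθ, V, hV, h⟩ := h
  refine ⟨θ, hθ, V, hV, ?_⟩
  rcases eq_or_ne (μ (Metric.closedBall x r)) 0 with h₀ | h₀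
  · have hsub : truncCone x r V α \ H x θ α ⊆ Metric.closedBall x r :=
      Set.sdiff_subset.trans Set.inter_subset_left
    exact (measure_mono_null hsub h₀).trans_le zero_le
  · exact (ENNReal.div_le_iff h₀ measure_closedBall_lt_top.ne).1 h.le

end HausdorffDimension

end ConicalDensity

theorem theorem4p1_general (n m : ℕ) (hm : m < n) (s : ℝ) (hs : (m : ℝ) < s) (α : ℝ)
    (hα0 : 0 < α) :
    ∃ c : ℝ, 0 < c ∧
      ∀ (μ : Measure (ConicalDensity.Rn n)) [IsLocallyFiniteMeasure μ],
        ENNReal.ofReal s ≤ ConicalDensity.hausdorffDim μ →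
          ∀ᵐ x ∂μ,
            ENNReal.ofReal c <
              limsup (fun r : ℝ =>
                ⨅ θ ∈ ConicalDensity.unitSphere n,
                  ⨅ V ∈ ConicalDensity.grassmannian n (n - m),
                    μ (ConicalDensity.truncCone x r V α \ ConicalDensity.H x θ α) /
                      μ (Metric.closedBall x r))
                (𝓝[>] (0 : ℝ)) := by
  obtain ⟨d, hmd, hds⟩ := exists_between hs
  lift d to NNReal using m.cast_nonneg.trans hmd.le
  obtain ⟨c, hc, hc', hdim⟩ := ConicalDensity.exists_hausdorffDim_le_of_isThinAt hm hα0 hmd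
  have hc₂ : c / 2 ≠ ⊤ := ENNReal.div_ne_top hc' two_ne_zero
  refine ⟨(c / 2).toReal, ENNReal.toReal_pos (ENNReal.half_pos hc).ne' hc₂, fun μ _ hμ => ?_⟩
  rw [ENNReal.ofReal_toReal hc₂]
  have hds' : (d : ℝ≥0∞) < ENNReal.ofReal s := by
    rw [← ENNReal.ofReal_coe_nnreal]
    exact (ENNReal.ofReal_lt_ofReal_iff (d.coe_nonneg.trans_lt hds)).2 hds
  have hthin : μ {x | ∀ᶠ r in 𝓝[>] 0, ConicalDensity.IsThinAt μ m α c r x} = 0 :=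
    by_contra fun h => (hds'.trans_le (hμ.trans (hdim μ h))).false
  refine ae_iff.2 (measure_mono_null (fun x hx => ?_) hthin)
  exact (eventually_lt_of_limsup_lt ((not_lt.1 hx).trans_lt (ENNReal.half_lt_self hc hc'))).mono
    fun r => ConicalDensity.isThinAt_of_iInf_lt

theorem theorem4p1 (n m : ℕ) (hm : m < n) (s : ℝ) (hs : (m : ℝ) < s)
    (α : ℝ) (hα0 : 0 < α) (hα1 : α ≤ 1) :
    ∃ c : ℝ, 0 < c ∧
      ∀ (μ : Measure (ConicalDensity.Rn n)) [IsFiniteMeasure μ],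
        ENNReal.ofReal s ≤ ConicalDensity.hausdorffDim μ →
          ∀ᵐ x ∂μ,
            ENNReal.ofReal c <
              limsup (fun r : ℝ =>
                ⨅ θ ∈ ConicalDensity.unitSphere n,
                  ⨅ V ∈ ConicalDensity.grassmannian n (n - m),
                    μ (ConicalDensity.truncCone x r V α \ ConicalDensity.H x θ α) /
                      μ (Metric.closedBall x r))
                (𝓝[>] (0 : ℝ)) := by
  obtain ⟨c, hc, h⟩ := theorem4p1_general n m hm s hs α hα0
  exact ⟨c, hc, fun μ _ => h μ⟩
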